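/- Let $n\in\mathbb{N}$ and let $p,q$ be real numbers with $1\le p<n$ and $p\le q<p^*$, where $p^*=\frac{np}{n-p}$. Let $W^{1,p}(\mathbb{R}^n)$ be the space of (real- or complex-valued) functions $f\in L^p(\mathbb{R}^n)$ whose distributional partial derivatives $\partial f/\partial x_j$, $j=1,\dots,n$, belong to $L^p(\mathbb{R}^n)$, with the norm \[ \|f\|_{1,p}=\Bigl(\int_{\mathbb{R}^n}\bigl(|f(x)|^p+|\nabla f(x)|_p^p\bigr)\,dx\Bigr)^{1/p},\qquad |\nabla f|_p=\Bigl(\sum_{j=1}^n\Bigl|\frac{\partial f}{\partial x_j}\Bigr|^p\Bigr)^{1/p}. \] Let $\mathcal{F}$ be a bounded subset of $W^{1,p}(\mathbb{R}^n)$. Assume that for every $\epsilon>0$ there exists some $R$ such that, for every $f\in\mathcal{F}$, \[ \int_{|x|>R}\bigl(|f(x)|^p+|\nabla f(x)|_p^p\bigr)\,dx<\epsilon^p . \] Then $\mathcal{F}$ is a subset of $L^q(\mathbb{R}^n)$ and is totally bounded there. -/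

import Mathlib

open MeasureTheory
open scoped ContDiff ENNReal

noncomputable section

/-- `g` is the weak (distributional) partial derivative `∂f/∂x_i` on `ℝ^n`: both functions are
locally integrable and `∫ f ∂φ/∂x_i = - ∫ g φ` for every test function `φ ∈ C_c^∞(ℝ^n)`. -/
def HasWeakPartialDeriv {𝕜 : Type*} [RCLike 𝕜] {n : ℕ} (i : Fin n)
    (f g : EuclideanSpace ℝ (Fin n) → 𝕜) : Prop :=
  LocallyIntegrable f volume ∧ LocallyIntegrable g volume ∧
    ∀ φ : EuclideanSpace ℝ (Fin n) → ℝ, ContDiff ℝ ∞ φ → HasCompactSupport φ →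
      ∫ x, (fderiv ℝ φ x (EuclideanSpace.single i 1)) • f x = -∫ x, φ x • g x

open Classical in
/-- The weak partial derivative `∂f/∂x_i`, which is unique up to a null set
(the zero function if there is none). -/
def weakPartialDeriv {𝕜 : Type*} [RCLike 𝕜] {n : ℕ} (i : Fin n)
    (f : EuclideanSpace ℝ (Fin n) → 𝕜) : EuclideanSpace ℝ (Fin n) → 𝕜 :=
  if h : ∃ g, HasWeakPartialDeriv i f g then h.choose else 0

/-- Weak partial derivatives are unique up to a null set. -/
theorem weakPartialDeriv_ae_eq {𝕜 : Type*} [RCLike 𝕜] {n : ℕ} {i : Fin n}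
    {f g : EuclideanSpace ℝ (Fin n) → 𝕜} (h : HasWeakPartialDeriv i f g) :
    weakPartialDeriv i f =ᵐ[volume] g := by
  have h' : HasWeakPartialDeriv i f (weakPartialDeriv i f) := by
    have hex : ∃ g, HasWeakPartialDeriv i f g := ⟨g, h⟩
    rw [weakPartialDeriv, dif_pos hex]
    exact hex.choose_spec
  refine ae_eq_of_integral_contDiff_smul_eq h'.2.1 h.2.1 fun φ hφ hc => ?_
  exact neg_injective ((h'.2.2 φ hφ hc).symm.trans (h.2.2 φ hφ hc))

/-- Membership in the Sobolev space `W^{1,p}(ℝ^n)`: `f` and its weak first-order partial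
derivatives belong to `L^p(ℝ^n)`. -/
def MemSobolevOne {𝕜 : Type*} [RCLike 𝕜] {n : ℕ} (p : ℝ)
    (f : EuclideanSpace ℝ (Fin n) → 𝕜) : Prop :=
  MemLp f (ENNReal.ofReal p) volume ∧
    ∀ i : Fin n, ∃ g, HasWeakPartialDeriv i f g ∧ MemLp g (ENNReal.ofReal p) volume

/-- The function `|f(x)|^p + |∇f(x)|_p^p`, where `|∇f|_p^p = ∑_i |∂f/∂x_i|^p`. -/
def sobolevDensity {𝕜 : Type*} [RCLike 𝕜] {n : ℕ} (p : ℝ)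
    (f : EuclideanSpace ℝ (Fin n) → 𝕜) (x : EuclideanSpace ℝ (Fin n)) : ℝ :=
  ‖f x‖ ^ p + ∑ i : Fin n, ‖weakPartialDeriv i f x‖ ^ p

/-- The Sobolev norm `‖f‖_{1,p} = (∫ (|f|^p + |∇f|_p^p) dx)^{1/p}`. -/
def sobolevNorm {𝕜 : Type*} [RCLike 𝕜] {n : ℕ} (p : ℝ)
    (f : EuclideanSpace ℝ (Fin n) → 𝕜) : ℝ :=
  (∫ x, sobolevDensity p f x) ^ (1 / p)

end

open scoped Convolution Topology NNReal
open Set Filter ContinuousLinearMap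

/-! The argument proves total boundedness in $L^p$ and transfers it to $L^q$ by interpolation
against the Sobolev exponent $r=p^*$.

In $L^p$ it is the Kolmogorov-Riesz argument. A bound on the weak gradient gives
$\|f-f(\cdot-t)\|_p\le |t|N$ uniformly over the family, so mollifying at a small fixed scale moves
every member by little. On a ball the mollified family is uniformly bounded and equicontinuous, so
Arzelà-Ascoli gives finite nets in the uniform norm, hence in $L^p$ of the ball. The tail hypothesis
handles the complement (`exists_finite_net_eLpNorm_of_translate_le`).

The Sobolev inequality bounds the family in $L^r$. Since $p\le q<r$, interpolation gives
$\|g\|_q\le\|g\|_p^a\|g\|_r^b$ with $a>0$. For $g=f$ this yields membership in $L^q$. For $g=f-t$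
the second factor is bounded and the first is small, so an $L^p$ net is an $L^q$ net.

Both the translate estimate and the Sobolev inequality are first proved for $C^1$ functions, then
passed to weakly differentiable ones through mollifications converging almost everywhere, with
Fatou. -/

/-- Minkowski's inequality for averages: the average of functions of `L^p` norm at most `C` has
`L^p` norm at most `C`. -/
theorem eLpNorm_integral_le_of_forall_le {α β G : Type*} [MeasurableSpace α] [MeasurableSpace β]
    [NormedAddCommGroup G] [NormedSpace ℝ G] {μ : Measure β} [IsProbabilityMeasure μ]
    {ν : Measure α} [SFinite ν] {F : α → β → G} {p C : ℝ≥0∞} (hp : 1 ≤ p) (hp' : p ≠ ⊤)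
    (hF : AEStronglyMeasurable (Function.uncurry F) (ν.prod μ))
    (h : ∀ᵐ y ∂μ, eLpNorm (fun x => F x y) p ν ≤ C) :
    eLpNorm (fun x => ∫ y, F x y ∂μ) p ν ≤ C := by
  have hp0 : p ≠ 0 := (zero_lt_one.trans_le hp).ne'
  have hpos : 0 < p.toReal := ENNReal.toReal_pos hp0 hp'
  rw [eLpNorm_eq_lintegral_rpow_enorm_toReal hp0 hp', one_div, ENNReal.rpow_inv_le_iff hpos]
  -- Jensen's inequality for the probability measure `μ`; Tonelli then exchanges the integrals.
  have key : ∀ᵐ x ∂ν, ‖∫ y, F x y ∂μ‖ₑ ^ p.toReal ≤ ∫⁻ y, ‖F x y‖ₑ ^ p.toReal ∂μ := by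
    filter_upwards [hF.prodMk_left] with x hx
    have h1 := eLpNorm_le_eLpNorm_of_exponent_le hp hx
    rw [eLpNorm_one_eq_lintegral_enorm, eLpNorm_eq_lintegral_rpow_enorm_toReal hp0 hp'] at h1
    rw [← ENNReal.le_rpow_inv_iff hpos, ← one_div]
    exact (enorm_integral_le_lintegral_enorm _).trans h1
  calc ∫⁻ x, ‖∫ y, F x y ∂μ‖ₑ ^ p.toReal ∂ν
      ≤ ∫⁻ x, ∫⁻ y, ‖F x y‖ₑ ^ p.toReal ∂μ ∂ν := lintegral_mono_ae key
    _ = ∫⁻ y, ∫⁻ x, ‖F x y‖ₑ ^ p.toReal ∂ν ∂μ :=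
        lintegral_lintegral_swap (hF.enorm.pow_const _)
    _ ≤ ∫⁻ _, C ^ p.toReal ∂μ := by
        refine lintegral_mono_ae ?_
        filter_upwards [h] with y hy
        rwa [← ENNReal.rpow_inv_le_iff hpos, ← one_div, ← eLpNorm_eq_lintegral_rpow_enorm_toReal hp0 hp']
    _ = C ^ p.toReal := by simp

/-! ### Mollifications as averages of translates -/

section Mollification

variable {E G : Type*} [NormedAddCommGroup E] [InnerProductSpace ℝ E] [FiniteDimensional ℝ E]
  [MeasurableSpace E] [BorelSpace E] [NormedAddCommGroup G] [NormedSpace ℝ G]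

/-- The probability measure whose density is a normed bump function. -/
noncomputable def ContDiffBump.normedMeasure (φ : ContDiffBump (0 : E)) : Measure E :=
  volume.withDensity fun t => ENNReal.ofReal (φ.normed volume t)

instance (φ : ContDiffBump (0 : E)) : IsProbabilityMeasure φ.normedMeasure := by
  constructor
  rw [ContDiffBump.normedMeasure, withDensity_apply _ MeasurableSet.univ, setLIntegral_univ,
    ← ofReal_integral_eq_lintegral_ofReal φ.integrable_normed
      (ae_of_all _ φ.nonneg_normed), φ.integral_normed, ENNReal.ofReal_one]

theorem ContDiffBump.integral_normedMeasure (φ : ContDiffBump (0 : E)) (g : E → G) :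
    ∫ t, g t ∂φ.normedMeasure = ∫ t, φ.normed volume t • g t := by
  rw [ContDiffBump.normedMeasure, integral_withDensity_eq_integral_toReal_smul₀
    (φ.continuous_normed.measurable.ennreal_ofReal.aemeasurable) (by simp)]
  simp_rw [ENNReal.toReal_ofReal (φ.nonneg_normed _)]

theorem ContDiffBump.ae_normedMeasure_norm_lt (φ : ContDiffBump (0 : E)) :
    ∀ᵐ t ∂φ.normedMeasure, ‖t‖ < φ.rOut := by
  rw [ContDiffBump.normedMeasure, ae_withDensity_iff
    φ.continuous_normed.measurable.ennreal_ofReal]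
  refine ae_of_all _ fun t ht => ?_
  have : t ∈ Function.support (φ.normed volume) := by
    intro h0
    simp [h0] at ht
  rw [φ.support_normed_eq] at this
  simpa using this

/-- Being an average of translates over a probability measure, a mollification falls under
Minkowski's inequality for averages. -/
theorem ContDiffBump.convolution_eq_integral_normedMeasure (φ : ContDiffBump (0 : E)) (f : E → G)
    (x : E) :
    (φ.normed volume ⋆[lsmul ℝ ℝ, volume] f) x = ∫ t, f (x - t) ∂φ.normedMeasure := by
  rw [φ.integral_normedMeasure]; rfl

omit [NormedSpace ℝ G] in
theorem ContDiffBump.aestronglyMeasurable_sub_normedMeasure (φ : ContDiffBump (0 : E)) {f : E → G}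
    (hf : AEStronglyMeasurable f volume) :
    AEStronglyMeasurable (Function.uncurry fun x t => f (x - t))
      ((volume : Measure E).prod φ.normedMeasure) :=
  hf.comp_quasiMeasurePreserving
    (quasiMeasurePreserving_sub_of_right_invariant volume φ.normedMeasure)

theorem ContDiffBump.integrable_normedMeasure (φ : ContDiffBump (0 : E)) {f : E → G}
    (hf : LocallyIntegrable f volume) (x : E) :
    Integrable (fun t => f (x - t)) φ.normedMeasure := by
  have h := φ.hasCompactSupport_normed.convolutionExists_left (lsmul ℝ ℝ : ℝ →L[ℝ] G →L[ℝ] G)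
    (φ.continuous_normed (μ := volume)) hf x
  rw [ContDiffBump.normedMeasure, integrable_withDensity_iff_integrable_smul₀'
    (φ.continuous_normed.measurable.ennreal_ofReal.aemeasurable) (by simp)]
  simp_rw [ENNReal.toReal_ofReal (φ.nonneg_normed _)]
  exact h

/-- Mollification does not increase the `L^p` norm. -/
theorem ContDiffBump.eLpNorm_convolution_le (φ : ContDiffBump (0 : E)) {f : E → G} {p : ℝ≥0∞}
    (hp : 1 ≤ p) (hp' : p ≠ ⊤) (hf : AEStronglyMeasurable f volume) :
    eLpNorm (φ.normed volume ⋆[lsmul ℝ ℝ, volume] f) p volume ≤ eLpNorm f p volume := by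
  have : (φ.normed volume ⋆[lsmul ℝ ℝ, volume] f) = fun x => ∫ t, f (x - t) ∂φ.normedMeasure :=
    funext (φ.convolution_eq_integral_normedMeasure f)
  rw [this]
  refine eLpNorm_integral_le_of_forall_le hp hp' (φ.aestronglyMeasurable_sub_normedMeasure hf) ?_
  exact ae_of_all _ fun t =>
    (eLpNorm_comp_measurePreserving hf (measurePreserving_sub_right volume t)).le

/-- The distance of `f` to its mollification is controlled by its translates. -/
theorem ContDiffBump.eLpNorm_sub_convolution_le (φ : ContDiffBump (0 : E)) [CompleteSpace G]
    {f : E → G} {p C : ℝ≥0∞}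
    (hp : 1 ≤ p) (hp' : p ≠ ⊤) (hf : LocallyIntegrable f volume)
    (h : ∀ t, ‖t‖ < φ.rOut → eLpNorm (fun x => f x - f (x - t)) p volume ≤ C) :
    eLpNorm (f - (φ.normed volume ⋆[lsmul ℝ ℝ, volume] f)) p volume ≤ C := by
  have : f - (φ.normed volume ⋆[lsmul ℝ ℝ, volume] f) =
      fun x => ∫ t, (f x - f (x - t)) ∂φ.normedMeasure := by
    ext x
    rw [integral_sub (integrable_const _) (φ.integrable_normedMeasure hf x), Pi.sub_apply,
      φ.convolution_eq_integral_normedMeasure f]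
    simp
  rw [this]
  refine eLpNorm_integral_le_of_forall_le hp hp' ?_ ?_
  · exact hf.aestronglyMeasurable.comp_fst.sub
      (φ.aestronglyMeasurable_sub_normedMeasure hf.aestronglyMeasurable)
  · filter_upwards [φ.ae_normedMeasure_norm_lt] with t ht using h t ht

/-- The translates of a `C^1` function differ from it by at most the `L^p` norm of its derivative
times the length of the translation. -/
theorem eLpNorm_sub_translate_le [CompleteSpace G] {u : E → G} (hu : ContDiff ℝ 1 u) {p : ℝ≥0∞}
    (hp : 1 ≤ p) (hp' : p ≠ ⊤) (t : E) :
    eLpNorm (fun x => u x - u (x - t)) p volume ≤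
      ‖t‖ₑ * eLpNorm (fderiv ℝ u) p volume := by
  have hc : Continuous (fderiv ℝ u) := hu.continuous_fderiv one_ne_zero
  have hprob : IsProbabilityMeasure ((volume : Measure ℝ).restrict (Ioc 0 1)) := ⟨by simp⟩
  -- The fundamental theorem of calculus along the segment from `x - t` to `x` makes the difference
  -- an average over the unit interval.
  have : (fun x => u x - u (x - t)) =
      fun x => ∫ s in Ioc (0 : ℝ) 1, fderiv ℝ u (x - t + s • t) t := by
    ext x
    have hd : ∀ s ∈ uIcc (0 : ℝ) 1,
        HasDerivAt (fun s : ℝ => u (x - t + s • t)) (fderiv ℝ u (x - t + s • t) t) s := by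
      intro s _
      have h1 : HasDerivAt (fun s : ℝ => x - t + s • t) t s := by
        simpa using ((hasDerivAt_id s).smul_const t).const_add (x - t)
      exact (hu.differentiable one_ne_zero _).hasFDerivAt.comp_hasDerivAt s h1
    have := intervalIntegral.integral_eq_sub_of_hasDerivAt hd
      (Continuous.intervalIntegrable (by fun_prop) _ _)
    rw [intervalIntegral.integral_of_le zero_le_one] at this
    rw [this]
    simp
  rw [this]
  refine eLpNorm_integral_le_of_forall_le hp hp' ?_ (ae_of_all _ fun s => ?_)
  · refine Continuous.aestronglyMeasurable ?_
    simp only [Function.uncurry_def]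
    fun_prop
  · have h1 : eLpNorm (fun x => fderiv ℝ u (x - t + s • t) t) p volume ≤
        ‖t‖ₑ * eLpNorm (fun x => fderiv ℝ u (x - t + s • t)) p volume := by
      refine (eLpNorm_le_nnreal_smul_eLpNorm_of_ae_le_mul (c := ‖t‖₊) (ae_of_all _ fun x => ?_)
        p).trans_eq rfl
      rw [mul_comm]
      exact le_opNorm _ _
    refine h1.trans_eq ?_
    congr 1
    have := eLpNorm_comp_measurePreserving (p := p) hc.aestronglyMeasurable
      (measurePreserving_add_right (volume : Measure E) (s • t - t))
    rw [← this]
    congr 1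
    ext1 x
    simp only [Function.comp]
    congr 1
    abel

end Mollification

/-- A sequence of bump functions with shrinking supports and comparable radii. -/
theorem exists_seq_contDiffBump (E : Type*) [NormedAddCommGroup E] :
    ∃ φ : ℕ → ContDiffBump (0 : E), Tendsto (fun k => (φ k).rOut) atTop (𝓝 0) ∧
      ∀ k, (φ k).rOut ≤ 2 * (φ k).rIn := by
  have hpos (k : ℕ) : (0 : ℝ) < 1 / ((k : ℝ) + 1) := Nat.one_div_pos_of_nat
  refine ⟨fun k => ⟨1 / ((k : ℝ) + 1), 2 * (1 / ((k : ℝ) + 1)), hpos k, ?_⟩, ?_, fun k => le_rfl⟩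
  · linarith [hpos k]
  · simpa using (tendsto_one_div_add_atTop_nhds_zero_nat (𝕜 := ℝ)).const_mul 2

/-! ### The Sobolev inequality for $C^1$ functions -/

section Sobolev

variable {E G : Type*} [NormedAddCommGroup E] [InnerProductSpace ℝ E] [FiniteDimensional ℝ E]
  [MeasurableSpace E] [BorelSpace E] [NormedAddCommGroup G] [NormedSpace ℝ G]

/-- The **Sobolev inequality** for `C^1` functions that need not have compact support. -/
theorem exists_eLpNorm_le_add_eLpNorm_fderiv [FiniteDimensional ℝ G] {p p' : ℝ≥0} (hp : 1 ≤ p)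
    (hn : 0 < Module.finrank ℝ E) (hp' : (p' : ℝ)⁻¹ = p⁻¹ - (Module.finrank ℝ E : ℝ)⁻¹) :
    ∃ C : ℝ≥0, ∀ u : E → G, ContDiff ℝ 1 u →
      eLpNorm u p' volume ≤ C * (eLpNorm u p volume + eLpNorm (fderiv ℝ u) p volume) := by
  -- Cut off by `χ (r k • x)` with `r k → 0`. As `r k ≤ 1`, the gradient of the cutoff stays below
  -- `K`, so the constant does not depend on `k`.
  let χ : ContDiffBump (0 : E) := ⟨1, 2, one_pos, one_lt_two⟩
  have hχ : ContDiff ℝ 1 χ := χ.contDiff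
  obtain ⟨K, hK⟩ := (χ.hasCompactSupport.fderiv ℝ).exists_bound_of_continuous
    (hχ.continuous_fderiv one_ne_zero)
  have hK0 : 0 ≤ K := (norm_nonneg _).trans (hK 0)
  let S := SNormLESNormFDerivOfEqConst G (volume : Measure E) p
  refine ⟨S * (K.toNNReal + 1), fun u hu => ?_⟩
  have hcu : Continuous (fderiv ℝ u) := hu.continuous_fderiv one_ne_zero
  let r : ℕ → ℝ := fun k => 1 / ((k : ℝ) + 1)
  have hr0 (k) : 0 < r k := Nat.one_div_pos_of_nat
  have hr1 (k) : r k ≤ 1 := by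
    have : (0 : ℝ) ≤ k := k.cast_nonneg
    exact (div_le_one (by linarith)).2 (by linarith)
  let v : ℕ → E → G := fun k x => χ (r k • x) • u x
  have hd (k) (x) : HasFDerivAt (v k) (χ (r k • x) • fderiv ℝ u x +
      ((r k • fderiv ℝ χ (r k • x)).smulRight (u x))) x := by
    have h1 : HasFDerivAt (fun x : E => χ (r k • x)) (r k • fderiv ℝ χ (r k • x)) x := by
      have h2 : HasFDerivAt (fun x : E => r k • x) (r k • ContinuousLinearMap.id ℝ E) x :=
        (hasFDerivAt_id x).const_smul (r k)
      have h3 := ((hχ.differentiable one_ne_zero) (r k • x)).hasFDerivAt.comp x h2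
      simpa using! h3
    exact h1.smul (hu.differentiable one_ne_zero x).hasFDerivAt
  have hv (k) : ContDiff ℝ 1 (v k) := (hχ.comp (contDiff_const_smul (r k))).smul hu
  have hvc (k) : HasCompactSupport (v k) :=
    (χ.hasCompactSupport.comp_homeomorph (Homeomorph.smulOfNeZero (r k) (hr0 k).ne')).smul_right
  have hbound (k) : eLpNorm (fderiv ℝ (v k)) p volume ≤
      (K.toNNReal + 1 : ℝ≥0) * (eLpNorm u p volume + eLpNorm (fderiv ℝ u) p volume) := by
    have hfd : fderiv ℝ (v k) = (fun x => χ (r k • x) • fderiv ℝ u x) +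
        fun x => (r k • fderiv ℝ χ (r k • x)).smulRight (u x) := funext fun x => (hd k x).fderiv
    have hc1 : Continuous (fun x => χ (r k • x) • fderiv ℝ u x) := by
      have := χ.continuous
      fun_prop
    have hc2 : Continuous (fun x => (r k • fderiv ℝ χ (r k • x)).smulRight (u x)) := by
      have := ((hv k).continuous_fderiv one_ne_zero).sub hc1
      rwa [hfd, add_sub_cancel_left] at this
    have e1 : eLpNorm (fun x => χ (r k • x) • fderiv ℝ u x) p volume ≤
        eLpNorm (fderiv ℝ u) p volume := by
      refine eLpNorm_mono fun x => ?_
      rw [norm_smul, Real.norm_of_nonneg χ.nonneg]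
      exact mul_le_of_le_one_left (norm_nonneg _) χ.le_one
    have e2 : eLpNorm (fun x => (r k • fderiv ℝ χ (r k • x)).smulRight (u x)) p volume ≤
        K.toNNReal * eLpNorm u p volume := by
      refine (eLpNorm_le_nnreal_smul_eLpNorm_of_ae_le_mul (c := K.toNNReal)
        (ae_of_all _ fun x => ?_) p).trans_eq rfl
      rw [← NNReal.coe_le_coe, NNReal.coe_mul, coe_nnnorm, coe_nnnorm, Real.coe_toNNReal _ hK0,
        norm_smulRight_apply, norm_smul, Real.norm_of_nonneg (hr0 k).le]
      refine mul_le_mul_of_nonneg_right ?_ (norm_nonneg _)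
      exact (mul_le_of_le_one_left (norm_nonneg _) (hr1 k)).trans (hK _)
    rw [hfd]
    refine (eLpNorm_add_le hc1.aestronglyMeasurable hc2.aestronglyMeasurable
      (by exact_mod_cast hp)).trans ((add_le_add e1 e2).trans ?_)
    rw [mul_add, add_comm]
    push_cast
    gcongr
    · exact le_self_add
    · exact le_mul_of_one_le_left' le_add_self
  -- The cut-off functions converge pointwise to `u`, and Fatou carries the uniform bound to the
  -- limit.
  refine Lp.eLpNorm_le_of_ae_tendsto (u := atTop) (f := v) (Eventually.of_forall fun k => ?_)
    (fun k => (hv k).continuous.aestronglyMeasurable) (ae_of_all _ fun x => ?_)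
  · refine (eLpNorm_le_eLpNorm_fderiv_of_eq volume (hv k) (hvc k) hp hn hp').trans ?_
    rw [ENNReal.coe_mul, mul_assoc]
    gcongr
    exact hbound k
  · have h1 : Tendsto (fun k => r k • x) atTop (𝓝 0) := by
      simpa [r] using (tendsto_one_div_add_atTop_nhds_zero_nat (𝕜 := ℝ)).smul_const x
    have h2 := ((χ.continuous.tendsto 0).comp h1).smul_const (u x)
    have h3 : χ (0 : E) = 1 := χ.one_of_mem_closedBall (by simp [χ])
    simpa [h3] using h2

end Sobolev

/-! ### From $C^1$ functions to weak derivatives -/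

section WeakDerivative

variable {𝕜 : Type*} [RCLike 𝕜] {n : ℕ}

theorem EuclideanSpace.opNorm_le_sum {G : Type*} [NormedAddCommGroup G] [NormedSpace ℝ G]
    (T : EuclideanSpace ℝ (Fin n) →L[ℝ] G) :
    ‖T‖ ≤ ∑ i, ‖T (EuclideanSpace.single i 1)‖ := by
  refine T.opNorm_le_bound (Finset.sum_nonneg fun _ _ => norm_nonneg _) fun x => ?_
  have hx : x = ∑ i, x i • EuclideanSpace.single i (1 : ℝ) := by
    simpa using ((EuclideanSpace.basisFun (Fin n) ℝ).sum_repr x).symm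
  conv_lhs => rw [hx, map_sum]
  rw [Finset.sum_mul]
  refine (norm_sum_le _ _).trans (Finset.sum_le_sum fun i _ => ?_)
  rw [map_smul, norm_smul, mul_comm]
  gcongr
  exact PiLp.norm_apply_le x i

/-- The partial derivative of a mollification is the mollification of the weak partial
derivative. -/
theorem HasWeakPartialDeriv.fderiv_convolution {i : Fin n} {f g : EuclideanSpace ℝ (Fin n) → 𝕜}
    (h : HasWeakPartialDeriv i f g) {ψ : EuclideanSpace ℝ (Fin n) → ℝ} (hψ : ContDiff ℝ ∞ ψ)
    (hc : HasCompactSupport ψ) (x : EuclideanSpace ℝ (Fin n)) :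
    fderiv ℝ (ψ ⋆[lsmul ℝ ℝ, volume] f) x (EuclideanSpace.single i 1) =
      (ψ ⋆[lsmul ℝ ℝ, volume] g) x := by
  have hψ1 : ContDiff ℝ 1 ψ := hψ.of_le (by simp)
  have hint := (hc.fderiv ℝ).convolutionExists_left
    ((lsmul ℝ ℝ : ℝ →L[ℝ] 𝕜 →L[ℝ] 𝕜).precompL (EuclideanSpace ℝ (Fin n)))
    (hψ1.continuous_fderiv one_ne_zero) h.1 x
  rw [(hc.hasFDerivAt_convolution_left (lsmul ℝ ℝ : ℝ →L[ℝ] 𝕜 →L[ℝ] 𝕜) hψ1 h.1 x).fderiv,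
    convolution_def, ContinuousLinearMap.integral_apply hint, convolution_def]
  simp only [precompL_apply, lsmul_apply]
  -- The substitution `t ↦ x - t` moves the translation onto the kernel, so `ψ (x - ·)` serves as
  -- test function. The sign from its chain rule cancels the one in the definition of the weak
  -- derivative.
  rw [← integral_sub_left_eq_self _ volume x, ← integral_sub_left_eq_self (fun t => ψ t • _) volume x]
  simp only [sub_sub_cancel]
  have hh : HasCompactSupport fun t => ψ (x - t) :=
    hc.comp_homeomorph (Homeomorph.subLeft x)
  have h2 := h.2.2 (fun t => ψ (x - t)) (hψ.comp (contDiff_const.sub contDiff_id)) hh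
  have hd (t) : fderiv ℝ (fun t => ψ (x - t)) t = -fderiv ℝ ψ (x - t) := by
    have h1 : HasFDerivAt (fun t => x - t) (-ContinuousLinearMap.id ℝ _) t :=
      (hasFDerivAt_id t).const_sub x
    have h3 := ((hψ1.differentiable one_ne_zero) (x - t)).hasFDerivAt.comp t h1
    rw [HasFDerivAt.fderiv (f := fun t => ψ (x - t)) h3]
    ext; simp
  simp only [hd, neg_apply, neg_smul, integral_neg, neg_inj] at h2
  exact h2

variable {f : EuclideanSpace ℝ (Fin n) → 𝕜} {g : Fin n → EuclideanSpace ℝ (Fin n) → 𝕜}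

theorem ContDiffBump.contDiff_convolution {E G : Type*} [NormedAddCommGroup E]
    [InnerProductSpace ℝ E] [FiniteDimensional ℝ E] [MeasurableSpace E] [BorelSpace E]
    [NormedAddCommGroup G] [NormedSpace ℝ G] [CompleteSpace G]
    (φ : ContDiffBump (0 : E)) {f : E → G} (hf : LocallyIntegrable f volume) :
    ContDiff ℝ 1 (φ.normed volume ⋆[lsmul ℝ ℝ, volume] f) :=
  φ.hasCompactSupport_normed.contDiff_convolution_left _ (φ.contDiff_normed (n := 1)) hf

/-- Each partial derivative of the mollification is a mollified weak derivative, whose norm has not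
grown. The bound is independent of `φ`, so it survives shrinking the support. -/
theorem ContDiffBump.eLpNorm_fderiv_convolution_le (φ : ContDiffBump (0 : EuclideanSpace ℝ (Fin n)))
    (h : ∀ i, HasWeakPartialDeriv i f (g i)) (hf : LocallyIntegrable f volume)
    {p : ℝ≥0∞} (hp : 1 ≤ p) (hp' : p ≠ ⊤) :
    eLpNorm (fderiv ℝ (φ.normed volume ⋆[lsmul ℝ ℝ, volume] f)) p volume ≤
      ∑ i, eLpNorm (g i) p volume := by
  have hcont := (φ.contDiff_convolution hf).continuous_fderiv one_ne_zero
  calc _ ≤ eLpNorm (∑ i, fun x => ‖fderiv ℝ (φ.normed volume ⋆[lsmul ℝ ℝ, volume] f) x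
        (EuclideanSpace.single i 1)‖) p volume := by
        refine eLpNorm_mono_real fun x => ?_
        rw [Finset.sum_apply]
        exact EuclideanSpace.opNorm_le_sum _
    _ ≤ ∑ i, eLpNorm (fun x => ‖fderiv ℝ (φ.normed volume ⋆[lsmul ℝ ℝ, volume] f) x
        (EuclideanSpace.single i 1)‖) p volume :=
        eLpNorm_sum_le (fun i _ => (by fun_prop : Continuous _).aestronglyMeasurable) hp
    _ ≤ ∑ i, eLpNorm (g i) p volume := by
        refine Finset.sum_le_sum fun i _ => ?_
        rw [eLpNorm_norm]
        simp_rw [(h i).fderiv_convolution φ.contDiff_normed φ.hasCompactSupport_normed]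
        exact φ.eLpNorm_convolution_le hp hp' (h i).2.1.aestronglyMeasurable

/-- Translates of a function with weak derivatives in `L^p`. -/
theorem HasWeakPartialDeriv.eLpNorm_sub_translate_le (h : ∀ i, HasWeakPartialDeriv i f (g i))
    (hf : LocallyIntegrable f volume) {p : ℝ≥0∞} (hp : 1 ≤ p) (hp' : p ≠ ⊤)
    (t : EuclideanSpace ℝ (Fin n)) :
    eLpNorm (fun x => f x - f (x - t)) p volume ≤ ‖t‖ₑ * ∑ i, eLpNorm (g i) p volume := by
  obtain ⟨φ, hφ, hφ'⟩ := exists_seq_contDiffBump (EuclideanSpace ℝ (Fin n))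
  -- Almost everywhere convergence is Lebesgue differentiation, which needs the comparable radii.
  have hae := ContDiffBump.ae_convolution_tendsto_right_of_locallyIntegrable hφ
    (Eventually.of_forall hφ') hf
  have hae' := (measurePreserving_sub_right volume t).quasiMeasurePreserving.ae hae
  have hu (k) := (φ k).contDiff_convolution hf
  refine Lp.eLpNorm_le_of_ae_tendsto (u := atTop) (f := fun k x =>
    ((φ k).normed volume ⋆[lsmul ℝ ℝ, volume] f) x -
      ((φ k).normed volume ⋆[lsmul ℝ ℝ, volume] f) (x - t))
    (Eventually.of_forall fun k => ?_) (fun k => ?_) ?_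
  · refine (_root_.eLpNorm_sub_translate_le (hu k) hp hp' t).trans ?_
    gcongr
    exact (φ k).eLpNorm_fderiv_convolution_le h hf hp hp'
  · have := (hu k).continuous
    exact (by fun_prop : Continuous _).aestronglyMeasurable
  · filter_upwards [hae, hae'] with x h1 h2 using h1.sub h2

/-- The **Sobolev inequality** for functions with weak derivatives in `L^p`. -/
theorem HasWeakPartialDeriv.exists_eLpNorm_le {p p' : ℝ≥0} (hp : 1 ≤ p)
    (hn : 0 < n) (hp' : (p' : ℝ)⁻¹ = p⁻¹ - (n : ℝ)⁻¹) :
    ∃ C : ℝ≥0, ∀ (f : EuclideanSpace ℝ (Fin n) → 𝕜) (g : Fin n → EuclideanSpace ℝ (Fin n) → 𝕜),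
      (∀ i, HasWeakPartialDeriv i f (g i)) → LocallyIntegrable f volume →
      eLpNorm f p' volume ≤ C * (eLpNorm f p volume + ∑ i, eLpNorm (g i) p volume) := by
  obtain ⟨C, hC⟩ := exists_eLpNorm_le_add_eLpNorm_fderiv (E := EuclideanSpace ℝ (Fin n)) (G := 𝕜)
    hp (by simpa using hn) (by simpa using hp')
  refine ⟨C, fun f g h hf => ?_⟩
  obtain ⟨φ, hφ, hφ'⟩ := exists_seq_contDiffBump (EuclideanSpace ℝ (Fin n))
  have hu (k) := (φ k).contDiff_convolution hf
  have hp1 : (1 : ℝ≥0∞) ≤ p := by exact_mod_cast hp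
  refine Lp.eLpNorm_le_of_ae_tendsto (u := atTop) (Eventually.of_forall fun k => ?_)
    (fun k => (hu k).continuous.aestronglyMeasurable)
    (ContDiffBump.ae_convolution_tendsto_right_of_locallyIntegrable hφ
      (Eventually.of_forall hφ') hf)
  refine (hC _ (hu k)).trans ?_
  gcongr
  · exact (φ k).eLpNorm_convolution_le hp1 ENNReal.coe_ne_top hf.aestronglyMeasurable
  · exact (φ k).eLpNorm_fderiv_convolution_le h hf hp1 ENNReal.coe_ne_top

end WeakDerivative

/-- A kernel bounded by `c` and supported in `S`, integrated against an `L^p` function. -/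
theorem enorm_integral_smul_le_of_support_subset {α G : Type*} [MeasurableSpace α]
    [NormedAddCommGroup G] [NormedSpace ℝ G] {μ : Measure α} {k : α → ℝ} {S : Set α}
    (hS : MeasurableSet S) {c : ℝ≥0} (hk : ∀ t, ‖k t‖₊ ≤ c) (hkS : ∀ t ∉ S, k t = 0) {f : α → G}
    (hf : AEStronglyMeasurable f μ) {p : ℝ≥0∞} (hp : 1 ≤ p) :
    ‖∫ t, k t • f t ∂μ‖ₑ ≤ c * (eLpNorm f p μ * μ S ^ (1 - 1 / p.toReal)) := by
  calc ‖∫ t, k t • f t ∂μ‖ₑ ≤ ∫⁻ t, ‖k t • f t‖ₑ ∂μ := enorm_integral_le_lintegral_enorm _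
    _ ≤ ∫⁻ t, S.indicator (fun t => c * ‖f t‖ₑ) t ∂μ := by
        refine lintegral_mono fun t => ?_
        by_cases ht : t ∈ S
        · rw [indicator_of_mem ht, enorm_smul]
          gcongr
          exact ENNReal.coe_le_coe.2 (hk t)
        · simp [hkS t ht]
    _ = c * eLpNorm f 1 (μ.restrict S) := by
        rw [lintegral_indicator hS, lintegral_const_mul' _ _ ENNReal.coe_ne_top,
          eLpNorm_one_eq_lintegral_enorm]
    _ ≤ c * (eLpNorm f p μ * μ S ^ (1 - 1 / p.toReal)) := by
        gcongr
        refine (eLpNorm_le_eLpNorm_mul_rpow_measure_univ hp hf.restrict).trans ?_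
        rw [Measure.restrict_apply_univ]
        simp only [ENNReal.toReal_one, div_one]
        gcongr
        exact Measure.restrict_le_self

/-! ### Arzelà-Ascoli and Kolmogorov-Riesz -/

section Compactness

variable {E G : Type*} [NormedAddCommGroup E] [InnerProductSpace ℝ E] [FiniteDimensional ℝ E]
  [MeasurableSpace E] [BorelSpace E] [NormedAddCommGroup G] [NormedSpace ℝ G]

/-- The mollifications of a bounded subset of `L^p` have finite nets for the uniform distance on
balls. -/
theorem ContDiffBump.exists_finite_net_convolution [FiniteDimensional ℝ G]
    (φ : ContDiffBump (0 : E)) (R : ℝ) {F : Set (E → G)} {p M : ℝ≥0∞} (hp : 1 ≤ p) (hM : M ≠ ⊤)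
    (hF : ∀ f ∈ F, LocallyIntegrable f volume) (hFM : ∀ f ∈ F, eLpNorm f p volume ≤ M)
    {δ : ℝ} (hδ : 0 < δ) :
    ∃ T ⊆ F, T.Finite ∧ ∀ f ∈ F, ∃ t ∈ T, ∀ x ∈ Metric.closedBall (0 : E) R,
      ‖(φ.normed volume ⋆[lsmul ℝ ℝ, volume] f) x -
        (φ.normed volume ⋆[lsmul ℝ ℝ, volume] t) x‖ ≤ δ := by
  have : ProperSpace G := FiniteDimensional.proper_real G
  have : CompleteSpace G := FiniteDimensional.complete ℝ G
  have : CompactSpace (Metric.closedBall (0 : E) R) :=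
    isCompact_iff_compactSpace.1 (isCompact_closedBall 0 R)
  let ψ := φ.normed (volume : Measure E)
  have hψc : HasCompactSupport ψ := φ.hasCompactSupport_normed
  obtain ⟨K, hK⟩ := hψc.exists_bound_of_continuous φ.continuous_normed
  obtain ⟨L, hL⟩ := (φ.contDiff_normed (μ := (volume : Measure E)) (n := 1)).lipschitzWith_of_hasCompactSupport
    hψc one_ne_zero
  -- This ball contains the supports of all kernels `ψ (x - ·)` with `x` in the ball of radius `R`.
  let S := Metric.closedBall (0 : E) (R + φ.rOut)
  have hS : MeasurableSet S := measurableSet_closedBall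
  have hψS : ∀ x ∈ Metric.closedBall (0 : E) R, ∀ t ∉ S, ψ (x - t) = 0 := by
    intro x hx t ht
    by_contra h
    have h1 : x - t ∈ Function.support ψ := h
    rw [φ.support_normed_eq, mem_ball_zero_iff] at h1
    rw [mem_closedBall_zero_iff] at hx
    refine ht (mem_closedBall_zero_iff.2 ?_)
    calc ‖t‖ = ‖x - (x - t)‖ := by rw [sub_sub_cancel]
      _ ≤ ‖x‖ + ‖x - t‖ := norm_sub_le _ _
      _ ≤ R + φ.rOut := add_le_add hx h1.le
  obtain ⟨A, hA⟩ : ∃ A : ℝ≥0, M * volume S ^ (1 - 1 / p.toReal) = A := by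
    refine ⟨_, (ENNReal.coe_toNNReal (ENNReal.mul_ne_top hM ?_)).symm⟩
    refine ENNReal.rpow_ne_top_of_nonneg ?_ measure_closedBall_lt_top.ne
    rcases eq_or_ne p ⊤ with rfl | hp'
    · simp
    · have : 1 ≤ p.toReal := by
        rw [← ENNReal.toReal_one]
        exact ENNReal.toReal_mono hp' hp
      rw [sub_nonneg]
      exact (div_le_one (by linarith)).2 this
  have hconv (f : E → G) (x : E) : (ψ ⋆[lsmul ℝ ℝ, volume] f) x = ∫ t, ψ (x - t) • f t := by
    rw [convolution_eq_swap]; rfl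
  -- Used with `ψ (x - ·)` for uniform boundedness and with `ψ (x - ·) - ψ (y - ·)`, of size at most
  -- `L * ‖x - y‖`, for equicontinuity.
  have key {f : E → G} (hf : f ∈ F) {k : E → ℝ} {c : ℝ≥0} (hk : ∀ t, ‖k t‖₊ ≤ c)
      (hkS : ∀ t ∉ S, k t = 0) : ‖∫ t, k t • f t‖ ≤ c * A := by
    have h1 := enorm_integral_smul_le_of_support_subset hS hk hkS
      (hF f hf).aestronglyMeasurable hp
    have h2 : ‖∫ t, k t • f t‖ₑ ≤ ((c * A : ℝ≥0) : ℝ≥0∞) := by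
      refine h1.trans ?_
      rw [ENNReal.coe_mul, ← hA]
      gcongr
      exact hFM f hf
    exact_mod_cast ENNReal.coe_le_coe.1 h2
  have hcont (f : F) : Continuous (ψ ⋆[lsmul ℝ ℝ, volume] (f : E → G)) :=
    (φ.contDiff_convolution (hF f f.2)).continuous
  let Φ : F → BoundedContinuousFunction (Metric.closedBall (0 : E) R) G := fun f =>
    BoundedContinuousFunction.mkOfCompact
      ⟨fun x => (ψ ⋆[lsmul ℝ ℝ, volume] (f : E → G)) x, (hcont f).comp continuous_subtype_val⟩
  have hΦ (f : F) (x) : Φ f x = ∫ t, ψ (x - t) • (f : E → G) t := hconv _ _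
  have hcomp : IsCompact (closure (range Φ)) := by
    refine BoundedContinuousFunction.arzela_ascoli (Metric.closedBall (0 : G) (K.toNNReal * A))
      (isCompact_closedBall _ _) _ ?_ ?_
    · rintro _ x ⟨f, rfl⟩
      rw [mem_closedBall_zero_iff, hΦ]
      refine key f.2 (fun t => ?_) (hψS x x.2)
      rw [← NNReal.coe_le_coe]
      exact (hK _).trans (Real.le_coe_toNNReal K)
    · refine Metric.equicontinuous_of_continuity_modulus (fun s => L * s * A) ?_ _ ?_
      · have : Continuous fun s : ℝ => L * s * A := by fun_prop
        simpa using this.tendsto 0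
      · rintro x y ⟨_, f, rfl⟩
        have hint (z : E) : Integrable (fun t => ψ (z - t) • (f : E → G) t) volume := by
          have := hψc.convolutionExists_left (lsmul ℝ ℝ : ℝ →L[ℝ] G →L[ℝ] G)
            φ.continuous_normed (hF f f.2) z
          simpa [sub_sub_cancel] using this.comp_sub_left z
        rw [Subtype.dist_eq, dist_eq_norm, dist_eq_norm, hΦ, hΦ]
        rw [← integral_sub (hint x) (hint y)]
        simp_rw [← sub_smul]
        refine key (c := L * ‖(x : E) - y‖₊) f.2 (fun t => ?_) (fun t ht => ?_)
        · have := hL.dist_le_mul (x - t) (y - t)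
          rw [dist_sub_right, dist_eq_norm, dist_eq_norm] at this
          exact_mod_cast this
        · rw [hψS x x.2 t ht, hψS y y.2 t ht, sub_zero]
  obtain ⟨T, hTsub, hTfin, hT⟩ := Metric.finite_approx_of_totallyBounded
    (hcomp.totallyBounded.subset subset_closure) δ hδ
  choose s hs using fun y : T => hTsub y.2
  have : Finite T := hTfin
  refine ⟨range fun y => (s y : E → G), ?_, finite_range _, fun f hf => ?_⟩
  · rintro _ ⟨y, rfl⟩
    exact (s y).2
  · obtain ⟨y, hy, hfy⟩ := mem_iUnion₂.1 (hT ⟨⟨f, hf⟩, rfl⟩)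
    refine ⟨_, ⟨⟨y, hy⟩, rfl⟩, fun x hx => ?_⟩
    have h1 := (BoundedContinuousFunction.dist_coe_le_dist (f := Φ ⟨f, hf⟩) (g := y) ⟨x, hx⟩).trans
      (Metric.mem_ball.1 hfy).le
    have hy' : y = Φ (s ⟨y, hy⟩) := (hs ⟨y, hy⟩).symm
    rw [hy', dist_eq_norm] at h1
    exact h1

/-- A quantitative form of the **Kolmogorov-Riesz theorem**: a bounded tight subset of `L^p` whose
translates satisfy a uniform Lipschitz estimate has finite nets in `L^p`. -/
theorem exists_finite_net_eLpNorm_of_translate_le [FiniteDimensional ℝ G] {F : Set (E → G)}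
    {p M : ℝ≥0∞} (hp : 1 ≤ p) (hp' : p ≠ ⊤) (hM : M ≠ ⊤)
    (hF : ∀ f ∈ F, LocallyIntegrable f volume) (hFM : ∀ f ∈ F, eLpNorm f p volume ≤ M)
    (htrans : ∀ f ∈ F, ∀ t : E, eLpNorm (fun x => f x - f (x - t)) p volume ≤ ‖t‖ₑ * M)
    (htail : ∀ ε : ℝ≥0∞, ε ≠ 0 → ∃ R : ℝ, ∀ f ∈ F,
      eLpNorm f p (volume.restrict (Metric.closedBall 0 R)ᶜ) ≤ ε)
    {ε : ℝ≥0∞} (hε : ε ≠ 0) :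
    ∃ T ⊆ F, T.Finite ∧ ∀ f ∈ F, ∃ t ∈ T, eLpNorm (f - t) p volume ≤ ε := by
  have : CompleteSpace G := FiniteDimensional.complete ℝ G
  -- Three parts are spent inside the ball (two mollification errors and the uniform net), two on
  -- the tails of `f` and `t`.
  set η := ε / 5 with hη
  have hη0 : η ≠ 0 := ENNReal.div_ne_zero.2 ⟨hε, by simp⟩
  obtain ⟨R, hR⟩ := htail η hη0
  set B := Metric.closedBall (0 : E) R
  have hB : MeasurableSet B := measurableSet_closedBall
  obtain ⟨r, hr0, hr⟩ := ENNReal.exists_nnreal_pos_mul_lt hM hη0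
  let φ : ContDiffBump (0 : E) := ⟨r / 2, r, half_pos hr0, half_lt_self hr0⟩
  have hVol : volume B ^ p.toReal⁻¹ ≠ ⊤ :=
    ENNReal.rpow_ne_top_of_nonneg (by positivity) measure_closedBall_lt_top.ne
  obtain ⟨δ, hδ0, hδ⟩ := ENNReal.exists_nnreal_pos_mul_lt hVol hη0
  obtain ⟨T, hTF, hTfin, hT⟩ := φ.exists_finite_net_convolution R hp hM hF hFM
    (NNReal.coe_pos.2 hδ0)
  refine ⟨T, hTF, hTfin, fun f hf => ?_⟩
  obtain ⟨t, ht, hft⟩ := hT f hf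
  refine ⟨t, ht, ?_⟩
  have hmeas {u} (hu : u ∈ F) : AEStronglyMeasurable u volume := (hF u hu).aestronglyMeasurable
  have hmol {u} (hu : u ∈ F) :
      eLpNorm (u - (φ.normed volume ⋆[lsmul ℝ ℝ, volume] u)) p volume ≤ η := by
    refine φ.eLpNorm_sub_convolution_le hp hp' (hF u hu) fun s hs => (htrans u hu s).trans ?_
    refine le_trans ?_ hr.le
    gcongr
    exact ENNReal.coe_le_coe.2 (NNReal.coe_le_coe.1 hs.le)
  have hcm {u} (hu : u ∈ F) :
      AEStronglyMeasurable (φ.normed volume ⋆[lsmul ℝ ℝ, volume] u) volume :=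
    (φ.contDiff_convolution (hF u hu)).continuous.aestronglyMeasurable
  have hsplit : f - t = B.indicator (f - t) + Bᶜ.indicator (f - t) :=
    (indicator_self_add_compl B (f - t)).symm
  have hmid : eLpNorm ((φ.normed volume ⋆[lsmul ℝ ℝ, volume] f) -
      (φ.normed volume ⋆[lsmul ℝ ℝ, volume] t)) p (volume.restrict B) ≤ η := by
    refine (eLpNorm_le_of_ae_bound (C := δ) ?_).trans ?_
    · filter_upwards [ae_restrict_mem hB] with x hx using hft x hx
    · rw [Measure.restrict_apply_univ, mul_comm, ENNReal.ofReal_coe_nnreal]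
      exact hδ.le
  have hin : eLpNorm (f - t) p (volume.restrict B) ≤ η + η + η := by
    have : f - t = (f - (φ.normed volume ⋆[lsmul ℝ ℝ, volume] f)) +
        ((φ.normed volume ⋆[lsmul ℝ ℝ, volume] f) - (φ.normed volume ⋆[lsmul ℝ ℝ, volume] t)) -
        (t - (φ.normed volume ⋆[lsmul ℝ ℝ, volume] t)) := by abel
    rw [this]
    have a1 := ((hmeas hf).sub (hcm hf)).restrict (s := B)
    have a2 := ((hcm hf).sub (hcm (hTF ht))).restrict (s := B)
    have a3 := ((hmeas (hTF ht)).sub (hcm (hTF ht))).restrict (s := B)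
    refine (eLpNorm_sub_le (a1.add a2) a3 hp).trans (add_le_add
      ((eLpNorm_add_le a1 a2 hp).trans (add_le_add ?_ hmid)) ?_)
    · exact (eLpNorm_mono_measure _ Measure.restrict_le_self).trans (hmol hf)
    · exact (eLpNorm_mono_measure _ Measure.restrict_le_self).trans (hmol (hTF ht))
  have hout : eLpNorm (f - t) p (volume.restrict Bᶜ) ≤ η + η :=
    (eLpNorm_sub_le (hmeas hf).restrict (hmeas (hTF ht)).restrict hp).trans
      (add_le_add (hR f hf) (hR t (hTF ht)))
  have hm := (hmeas hf).sub (hmeas (hTF ht))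
  calc eLpNorm (f - t) p volume
      ≤ eLpNorm (B.indicator (f - t)) p volume + eLpNorm (Bᶜ.indicator (f - t)) p volume := by
        conv_lhs => rw [hsplit]
        exact eLpNorm_add_le (hm.indicator hB) (hm.indicator hB.compl) hp
    _ ≤ (η + η + η) + (η + η) := by
        rw [eLpNorm_indicator_eq_eLpNorm_restrict hB,
          eLpNorm_indicator_eq_eLpNorm_restrict hB.compl]
        exact add_le_add hin hout
    _ = 5 * η := by ring
    _ = ε := ENNReal.mul_div_cancel (by simp) (by simp)

end Compactness

/-! ### Interpolation between exponents -/

/-- Interpolation of `L^p` norms. -/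
theorem exists_forall_eLpNorm_le_mul_rpow {p q r : ℝ} (hp : 0 < p) (hpq : p ≤ q) (hqr : q < r) :
    ∃ a b : ℝ, 0 < a ∧ 0 ≤ b ∧ ∀ {α G : Type*} [MeasurableSpace α] [NormedAddCommGroup G]
      {μ : Measure α} {g : α → G}, AEStronglyMeasurable g μ →
      eLpNorm g (ENNReal.ofReal q) μ ≤
        eLpNorm g (ENNReal.ofReal p) μ ^ a * eLpNorm g (ENNReal.ofReal r) μ ^ b := by
  have hq : 0 < q := hp.trans_le hpq
  have hr : 0 < r := hq.trans hqr
  -- The weight with `p * s + r * (1 - s) = q`, for Hölder applied to `‖g‖ ^ p` and `‖g‖ ^ r`. It is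
  -- positive because `q < r`, whence `a > 0`.
  set s := (r - q) / (r - p) with hs
  have hrp : 0 < r - p := by linarith
  have hs0 : 0 < s := div_pos (by linarith) hrp
  have hs1 : s ≤ 1 := (div_le_one hrp).2 (by linarith)
  have hsq : p * s + r * (1 - s) = q := by
    rw [hs]; field_simp; ring
  refine ⟨p * s / q, r * (1 - s) / q, by positivity,
    div_nonneg (mul_nonneg hr.le (by linarith)) hq.le, fun {α G _ _ μ g} hg => ?_⟩
  have hn {t : ℝ} (ht : 0 < t) : eLpNorm g (ENNReal.ofReal t) μ =
      (∫⁻ x, ‖g x‖ₑ ^ t ∂μ) ^ t⁻¹ := by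
    rw [eLpNorm_eq_lintegral_rpow_enorm_toReal (by simpa using ht) ENNReal.ofReal_ne_top,
      ENNReal.toReal_ofReal ht.le, one_div]
  have h := ENNReal.lintegral_mul_norm_pow_le (μ := μ) (hg.enorm.pow_const p) (hg.enorm.pow_const r)
    hs0.le (by linarith : 0 ≤ 1 - s) (by ring)
  have h1 : ∀ x, (‖g x‖ₑ ^ p) ^ s * (‖g x‖ₑ ^ r) ^ (1 - s) = ‖g x‖ₑ ^ q := fun x => by
    rw [← ENNReal.rpow_mul, ← ENNReal.rpow_mul, ← ENNReal.rpow_add_of_nonneg _ _ (by positivity)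
      (mul_nonneg hr.le (by linarith)), hsq]
  simp_rw [h1] at h
  rw [hn hp, hn hq, hn hr, ENNReal.rpow_inv_le_iff hq,
    ENNReal.mul_rpow_of_nonneg _ _ hq.le, ← ENNReal.rpow_mul, ← ENNReal.rpow_mul,
    ← ENNReal.rpow_mul, ← ENNReal.rpow_mul]
  convert h using 3 <;> field_simp

/-! ### Bounds by the Sobolev norm -/

section SobolevSpace

variable {𝕜 : Type*} [RCLike 𝕜] {n : ℕ} {p : ℝ} {f : EuclideanSpace ℝ (Fin n) → 𝕜}

theorem MemSobolevOne.hasWeakPartialDeriv (h : MemSobolevOne p f) (i : Fin n) :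
    HasWeakPartialDeriv i f (weakPartialDeriv i f) := by
  have hex : ∃ g, HasWeakPartialDeriv i f g := (h.2 i).imp fun _ hg => hg.1
  rw [weakPartialDeriv, dif_pos hex]
  exact hex.choose_spec

theorem MemSobolevOne.memLp_weakPartialDeriv (h : MemSobolevOne p f) (i : Fin n) :
    MemLp (weakPartialDeriv i f) (ENNReal.ofReal p) volume := by
  obtain ⟨g, hg, hgp⟩ := h.2 i
  exact hgp.ae_eq (weakPartialDeriv_ae_eq hg).symm

theorem MemSobolevOne.integrable_sobolevDensity (hp : 1 ≤ p) (h : MemSobolevOne p f) :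
    Integrable (sobolevDensity p f) volume := by
  have hi {g : EuclideanSpace ℝ (Fin n) → 𝕜} (hg : MemLp g (ENNReal.ofReal p) volume) :
      Integrable (fun x => ‖g x‖ ^ p) volume := by
    have := hg.integrable_norm_rpow (by simp; linarith) ENNReal.ofReal_ne_top
    rwa [ENNReal.toReal_ofReal (by linarith)] at this
  exact (hi h.1).add (integrable_finsetSum _ fun i _ => hi (h.memLp_weakPartialDeriv i))

/-- With `S` the whole space it gives the norm bounds for `f` and its weak derivatives; with `S` the
exterior of a ball, the tail bound. -/
theorem MemSobolevOne.eLpNorm_restrict_le (hp : 1 ≤ p) (h : MemSobolevOne p f)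
    (S : Set (EuclideanSpace ℝ (Fin n))) {g : EuclideanSpace ℝ (Fin n) → 𝕜}
    (hg : MemLp g (ENNReal.ofReal p) volume) (hgf : ∀ x, ‖g x‖ ^ p ≤ sobolevDensity p f x) :
    eLpNorm g (ENNReal.ofReal p) (volume.restrict S) ≤
      ENNReal.ofReal ((∫ x in S, sobolevDensity p f x) ^ (1 / p)) := by
  have hp0 : 0 < p := by linarith
  have hgS := hg.restrict S
  have hi := hgS.integrable_norm_rpow (by simpa using hp0) ENNReal.ofReal_ne_top
  rw [hgS.eLpNorm_eq_integral_rpow_norm (by simpa using hp0) ENNReal.ofReal_ne_top]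
  rw [ENNReal.toReal_ofReal hp0.le] at hi ⊢
  rw [one_div]
  exact ENNReal.ofReal_le_ofReal (Real.rpow_le_rpow (integral_nonneg fun x => by positivity)
    (integral_mono hi (h.integrable_sobolevDensity hp).integrableOn hgf) (by positivity))

theorem norm_rpow_le_sobolevDensity (f : EuclideanSpace ℝ (Fin n) → 𝕜)
    (x : EuclideanSpace ℝ (Fin n)) : ‖f x‖ ^ p ≤ sobolevDensity p f x :=
  le_add_of_nonneg_right (Finset.sum_nonneg fun _ _ => by positivity)

theorem norm_weakPartialDeriv_rpow_le_sobolevDensity (f : EuclideanSpace ℝ (Fin n) → 𝕜)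
    (i : Fin n) (x : EuclideanSpace ℝ (Fin n)) :
    ‖weakPartialDeriv i f x‖ ^ p ≤ sobolevDensity p f x := by
  have h1 : ‖weakPartialDeriv i f x‖ ^ p ≤ ∑ i : Fin n, ‖weakPartialDeriv i f x‖ ^ p :=
    Finset.single_le_sum (f := fun i : Fin n => ‖weakPartialDeriv i f x‖ ^ p)
      (fun _ _ => by positivity) (Finset.mem_univ i)
  exact h1.trans (le_add_of_nonneg_left (by positivity))

theorem MemSobolevOne.eLpNorm_le_sobolevNorm (hp : 1 ≤ p) (h : MemSobolevOne p f) :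
    eLpNorm f (ENNReal.ofReal p) volume ≤ ENNReal.ofReal (sobolevNorm p f) := by
  simpa [sobolevNorm] using h.eLpNorm_restrict_le hp univ h.1 (norm_rpow_le_sobolevDensity f)

theorem MemSobolevOne.eLpNorm_weakPartialDeriv_le_sobolevNorm (hp : 1 ≤ p) (h : MemSobolevOne p f)
    (i : Fin n) :
    eLpNorm (weakPartialDeriv i f) (ENNReal.ofReal p) volume ≤
      ENNReal.ofReal (sobolevNorm p f) := by
  simpa [sobolevNorm] using h.eLpNorm_restrict_le hp univ (h.memLp_weakPartialDeriv i)
    (norm_weakPartialDeriv_rpow_le_sobolevDensity f i)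

/-- The `L^p` norm of `f` plus those of its weak derivatives, in terms of the Sobolev norm. -/
theorem MemSobolevOne.add_sum_eLpNorm_le (hp : 1 ≤ p) (h : MemSobolevOne p f) :
    eLpNorm f (ENNReal.ofReal p) volume +
      ∑ i, eLpNorm (weakPartialDeriv i f) (ENNReal.ofReal p) volume ≤
      (n + 1) * ENNReal.ofReal (sobolevNorm p f) := by
  refine (add_le_add (h.eLpNorm_le_sobolevNorm hp) (Finset.sum_le_sum fun i _ =>
    h.eLpNorm_weakPartialDeriv_le_sobolevNorm hp i)).trans_eq ?_
  simp
  ring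

end SobolevSpace

/-! ### Compactness in $L^q$ -/

theorem mainTheorem4 {𝕜 : Type*} [RCLike 𝕜] (n : ℕ) (p q : ℝ)
    (hp : 1 ≤ p) (hpn : p < n) (hpq : p ≤ q) (hq : q < n * p / (n - p))
    (F : Set (EuclideanSpace ℝ (Fin n) → 𝕜))
    (hF : ∀ f ∈ F, MemSobolevOne p f)
    (hbdd : ∃ M : ℝ, ∀ f ∈ F, sobolevNorm p f ≤ M)
    (htail : ∀ ε : ℝ, 0 < ε → ∃ R : ℝ, ∀ f ∈ F,
      ∫ x in {x : EuclideanSpace ℝ (Fin n) | R < ‖x‖}, sobolevDensity p f x < ε ^ p) :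
    haveI : Fact ((1 : ℝ≥0∞) ≤ ENNReal.ofReal q) :=
      ⟨ENNReal.one_le_ofReal.2 (hp.trans hpq)⟩
    (∀ f ∈ F, MemLp f (ENNReal.ofReal q) volume) ∧
      TotallyBounded {u : Lp 𝕜 (ENNReal.ofReal q)
        (volume : Measure (EuclideanSpace ℝ (Fin n))) | ∃ f ∈ F, u =ᵐ[volume] f} := by
  obtain ⟨M, hM⟩ := hbdd
  have hp0 : 0 < p := by linarith
  have hn : 0 < (n : ℝ) := hp0.trans hpn
  have hnp : 0 < (n : ℝ) - p := by linarith
  set r := n * p / (n - p) with hr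
  have hr0 : 0 < r := by positivity
  have hpE : (1 : ℝ≥0∞) ≤ ENNReal.ofReal p := ENNReal.one_le_ofReal.2 hp
  obtain ⟨C, hC⟩ := HasWeakPartialDeriv.exists_eLpNorm_le (𝕜 := 𝕜) (n := n) (p := p.toNNReal)
    (p' := r.toNNReal) (Real.one_le_toNNReal.2 hp) (by exact_mod_cast hn) (by
      rw [NNReal.coe_inv, Real.coe_toNNReal _ hp0.le, Real.coe_toNNReal _ hr0.le, hr]
      field_simp)
  set N : ℝ≥0∞ := (n + 1) * ENNReal.ofReal M
  have hN : N ≠ ⊤ := ENNReal.mul_ne_top (by simp) ENNReal.ofReal_ne_top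
  have hFN : ∀ f ∈ F, eLpNorm f (ENNReal.ofReal p) volume +
      ∑ i, eLpNorm (weakPartialDeriv i f) (ENNReal.ofReal p) volume ≤ N := fun f hf =>
    ((hF f hf).add_sum_eLpNorm_le hp).trans 
      (mul_le_mul' le_rfl (ENNReal.ofReal_le_ofReal (hM f hf)))
  have hloc : ∀ f ∈ F, LocallyIntegrable f volume := fun f hf => (hF f hf).1.locallyIntegrable hpE
  have hmeas : ∀ f ∈ F, AEStronglyMeasurable f volume := fun f hf => (hF f hf).1.1
  have hFr : ∀ f ∈ F, eLpNorm f (ENNReal.ofReal r) volume ≤ C * N := fun f hf =>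
    (hC f _ (hF f hf).hasWeakPartialDeriv (hloc f hf)).trans (mul_le_mul' le_rfl (hFN f hf))
  have hCN : C * N ≠ ⊤ := ENNReal.mul_ne_top ENNReal.coe_ne_top hN
  obtain ⟨a, b, ha, hb, hab⟩ := exists_forall_eLpNorm_le_mul_rpow hp0 hpq hq
  have hmem : ∀ f ∈ F, MemLp f (ENNReal.ofReal q) volume := fun f hf =>
    ⟨hmeas f hf, (hab (hmeas f hf)).trans_lt (ENNReal.mul_lt_top
      (ENNReal.rpow_lt_top_of_nonneg ha.le (hF f hf).1.2.ne)
      (ENNReal.rpow_lt_top_of_nonneg hb ((hFr f hf).trans_lt hCN.lt_top).ne))⟩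
  refine ⟨hmem, ?_⟩
  have : Fact ((1 : ℝ≥0∞) ≤ ENNReal.ofReal q) := ⟨ENNReal.one_le_ofReal.2 (hp.trans hpq)⟩
  have htail' : ∀ ε : ℝ≥0∞, ε ≠ 0 → ∃ R : ℝ, ∀ f ∈ F, eLpNorm f (ENNReal.ofReal p)
      (volume.restrict (Metric.closedBall 0 R)ᶜ) ≤ ε := by
    intro ε hε
    obtain ⟨η, hη0, hη⟩ := ENNReal.exists_nnreal_pos_mul_lt ENNReal.one_ne_top hε
    obtain ⟨R, hR⟩ := htail η hη0
    refine ⟨R, fun f hf => ?_⟩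
    have hset : (Metric.closedBall (0 : EuclideanSpace ℝ (Fin n)) R)ᶜ = {x | R < ‖x‖} := by
      ext x; simp
    rw [hset]
    refine ((hF f hf).eLpNorm_restrict_le hp _ (hF f hf).1
      (norm_rpow_le_sobolevDensity f)).trans ?_
    rw [mul_one] at hη
    refine le_trans ?_ hη.le
    rw [← ENNReal.ofReal_coe_nnreal]
    refine ENNReal.ofReal_le_ofReal ?_
    have h0 : 0 ≤ ∫ x in {x : EuclideanSpace ℝ (Fin n) | R < ‖x‖}, sobolevDensity p f x :=
      integral_nonneg fun x =>
        (Real.rpow_nonneg (norm_nonneg _) p).trans (norm_rpow_le_sobolevDensity f x)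
    rw [one_div]
    exact (Real.rpow_inv_le_iff_of_pos h0 η.2 hp0).2 (hR f hf).le
  have hnet {ε : ℝ≥0∞} (hε : ε ≠ 0) := exists_finite_net_eLpNorm_of_translate_le hpE
    ENNReal.ofReal_ne_top hN hloc (fun f hf => le_self_add.trans (hFN f hf))
    (fun f hf t => (HasWeakPartialDeriv.eLpNorm_sub_translate_le (hF f hf).hasWeakPartialDeriv
      (hloc f hf) hpE ENNReal.ofReal_ne_top t).trans
        (by gcongr; exact le_add_self.trans (hFN f hf))) htail' hε
  refine Metric.totallyBounded_iff.2 fun ε hε => ?_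
  have hD : (C * N + C * N) ^ b ≠ ⊤ :=
    ENNReal.rpow_ne_top_of_nonneg hb (ENNReal.add_ne_top.2 ⟨hCN, hCN⟩)
  -- Differences of members have $L^r$ norm at most `C * N + C * N`. An $L^p$ net of mesh `η ^ a⁻¹`
  -- thus has $L^q$ mesh at most `η * (C * N + C * N) ^ b`, which is below `ε`.
  obtain ⟨η, hη0, hη⟩ := ENNReal.exists_nnreal_pos_mul_lt hD (ENNReal.ofReal_pos.2 hε).ne'
  have hη' : (η : ℝ≥0∞) ^ a⁻¹ ≠ 0 := by
    rw [← ENNReal.coe_rpow_of_nonneg _ (by positivity)]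
    exact ENNReal.coe_ne_zero.2 (NNReal.rpow_pos hη0).ne'
  obtain ⟨T, hTF, hTfin, hT⟩ := hnet hη'
  have : Finite T := hTfin
  refine ⟨range fun t : T => (hmem t (hTF t.2)).toLp t, finite_range _, ?_⟩
  rintro u ⟨f, hf, huf⟩
  obtain ⟨t, ht, hft⟩ := hT f hf
  refine mem_iUnion₂.2 ⟨_, ⟨⟨t, ht⟩, rfl⟩, ?_⟩
  have hu : u = (hmem f hf).toLp f := Lp.ext (huf.trans (hmem f hf).coeFn_toLp.symm)
  have hlt : eLpNorm (f - t) (ENNReal.ofReal q) volume < ENNReal.ofReal ε := by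
    refine ((hab ((hmeas f hf).sub (hmeas t (hTF ht)))).trans (mul_le_mul' ?_ ?_)).trans_lt hη
    · exact (ENNReal.le_rpow_inv_iff ha).1 hft
    · refine ENNReal.rpow_le_rpow ?_ hb
      exact (eLpNorm_sub_le (hmeas f hf) (hmeas t (hTF ht))
        (ENNReal.one_le_ofReal.2 (hp.trans (hpq.trans hq.le)))).trans
        (add_le_add (hFr f hf) (hFr t (hTF ht)))
  rw [hu, ← Metric.eball_ofReal, Metric.mem_eball, Lp.edist_toLp_toLp]
  exact hlt
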